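/- All graphs are finite, simple and undirected. A cut vertex of a connected graph $G$ is a vertex whose removal makes the graph disconnected, and the Wiener index $W(G)=\sum_{\{u,v\}\subseteq V(G)}d_G(u,v)$ is the sum of the distances in $G$ over all unordered pairs of vertices. For $3\le g\le n$, let $L_{n,g}$ be the graph on $n$ vertices obtained by identifying an end vertex of the path $P_{n-g+1}$ on $n-g+1$ vertices with a vertex of the cycle $C_g$ on $g$ vertices. Theorem. Let $n\ge 10$ and let $G$ be a connected graph on $n$ vertices with exactly two cut vertices. Then $W(G)\le W(L_{n,n-2})$, and $W(G)=W(L_{n,n-2})$ if and only if $G\cong L_{n,n-2}$. -/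

import Mathlib

namespace WienerCut

/-- A cut vertex of a graph: a vertex whose removal leaves a disconnected graph (two remaining
vertices are not joined by a walk). It is used for connected graphs only. -/
def IsCutVertex {V : Type*} (G : SimpleGraph V) (v : V) : Prop :=
  ¬ (G.induce ({v}ᶜ : Set V)).Preconnected

/-- The number of cut vertices of a graph. -/
noncomputable def numCutVertices {V : Type*} (G : SimpleGraph V) : ℕ :=
  {v : V | IsCutVertex G v}.ncard

/-- The Wiener index: the sum of the distances `d(u, v)` over all unordered pairs `{u, v}` of
vertices (the degenerate pairs `{v, v}` contribute `0`). -/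
noncomputable def wienerIndex {V : Type*} [Fintype V] (G : SimpleGraph V) : ℕ :=
  ∑ p ∈ (Finset.univ : Finset V).sym2,
    Sym2.lift ⟨fun u v => G.dist u v, fun _ _ => SimpleGraph.dist_comm⟩ p

/-- The graph `L_{n,g}` (for `3 ≤ g ≤ n`) on the vertices `0, 1, …, n - 1`: the cycle `C_g` on
`0, 1, …, g - 1` together with the path `g - 1, g, …, n - 1` on `n - g + 1` vertices, an end of
which is the vertex `g - 1` of the cycle. Its edges are the pairs `{i, i + 1}` and the pair
`{0, g - 1}`. -/
def cyclePath (n g : ℕ) : SimpleGraph (Fin n) :=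
  SimpleGraph.fromRel fun i j : Fin n =>
    i.val + 1 = j.val ∨ (i.val = 0 ∧ j.val + 1 = g)

end WienerCut

/-! Write t(k) = ⌊k²/4⌋, the distance sum of a vertex of the cycle on k vertices. In a block with k
vertices, every distance level around a root, other than level 0, that has vertices beyond it
contains at least two vertices, since a single one would separate the block. Hence each distance sum
is at most t(k) (`distSum_le`), and for k ≥ 3 equality forces the root to have exactly two
neighbours (`card_adj_of_distSum_eq`).

The cut vertices u and v split G into a union A of blocks at u, a union B of blocks at v, and a
middle block M containing both (`exists_decomposition`). Distances add up across a cut vertex, so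
the doubled Wiener index is a weighted sum over A, B and M (`Decomposition.pairSum_eq`). Merging
several blocks at a cut vertex into one does not lower the bound, once an exceptional term is added
for the path on three vertices (`Star.bound`). This leaves a function `twoCutBound` of the three
sizes, which for n ≥ 10 lies strictly below `lollipopValue (n - 2)` unless M and one of A, B are
single edges (`twoCutBound_lt`).

Conversely, a 1-Lipschitz candidate for the distance gives 2 W(L) ≥ `lollipopValue (n - 2)`
(`lollipopValue_le`). If W(G) = W(L), all estimates are tight: the large piece is a block with all
degrees two, hence a cycle, and the two edges form the pendant path (`Extremal.nonempty_iso`). The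
exact value of W(L) is never needed. -/

namespace WienerCut

open Finset

/-! ### Distance levels in a block. -/

section LevelSets

variable {V : Type*} {G : SimpleGraph V}

/-- A finite vertex set is linked if it is not the union of two nonempty disjoint parts without
an edge between them; equivalently, it induces a preconnected graph. -/
def Linked (G : SimpleGraph V) (S : Finset V) : Prop :=
  ∀ P ⊆ S, P.Nonempty → (∀ x ∈ P, ∀ y ∈ S, y ∉ P → ¬ G.Adj x y) → P = S

/-- The sum of the distances from `x` to the vertices of `S`. -/
noncomputable def distSum (G : SimpleGraph V) (S : Finset V) (x : V) : ℕ := ∑ y ∈ S, G.dist x y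

/-- The sum of the distances over all ordered pairs of vertices of `S`. -/
noncomputable def pairSum (G : SimpleGraph V) (S : Finset V) : ℕ := ∑ x ∈ S, distSum G S x

theorem dist_le_dist_add_one (hG : G.Connected) (w : V) {x y : V} (h : G.Adj x y) :
    G.dist w y ≤ G.dist w x + 1 := by
  have := hG.dist_triangle (u := w) (v := x) (w := y)
  rwa [SimpleGraph.dist_eq_one_iff_adj.2 h] at this

theorem distSum_eq_sum_card {S : Finset V} {w : V} {N : ℕ} (h : ∀ y ∈ S, G.dist w y ≤ N) :
    distSum G S w = ∑ i ∈ range N, #{x ∈ S | i < G.dist w x} := by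
  simp only [card_filter]
  rw [sum_comm]
  refine sum_congr rfl fun y hy => ?_
  rw [← card_filter]
  have : {i ∈ range N | i < G.dist w y} = range (G.dist w y) := by
    ext i
    have := h y hy
    simp only [mem_filter, mem_range]
    omega
  rw [this, card_range]

theorem sum_range_sub_two_mul (k : ℕ) : ∑ i ∈ range k, (k - 1 - 2 * i) = k ^ 2 / 4 := by
  induction k using Nat.twoStepInduction with
  | zero => rfl
  | one => rfl
  | more k ih _ =>
    rw [sum_range_succ', sum_range_succ]
    have h1 : ∀ i ∈ range k, k + 2 - 1 - 2 * (i + 1) = k - 1 - 2 * i := fun i _ => by omega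
    rw [sum_congr rfl h1, ih]
    have : (k + 2) ^ 2 = k ^ 2 + (k + 1) * 4 := by ring
    rw [this, Nat.add_mul_div_right _ _ (by norm_num)]
    omega

theorem linked_of_preconnected {S : Finset V} (h : (G.induce (S : Set V)).Preconnected) :
    Linked G S := by
  intro P hP ⟨a, ha⟩ hcl
  refine Subset.antisymm hP fun b hb => ?_
  obtain ⟨p⟩ := h ⟨a, hP ha⟩ ⟨b, hb⟩
  have key : ∀ (x y : (S : Set V)) (_ : (G.induce (S : Set V)).Walk x y), x.1 ∈ P → y.1 ∈ P := by
    intro x y q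
    induction q with
    | nil => exact id
    | @cons x y z hxy _ ih =>
      intro hx
      refine ih ?_
      by_contra hy
      exact hcl _ hx _ y.2 hy hxy
  exact key _ _ p ha

theorem Linked.preconnected {S : Finset V} (h : Linked G S) :
    (G.induce (S : Set V)).Preconnected := by
  classical
  intro a b
  have := h (S.filter fun x => ∃ hx : x ∈ (S : Set V), (G.induce (S : Set V)).Reachable a ⟨x, hx⟩)
    (filter_subset _ _) ⟨a.1, mem_filter.2 ⟨a.2, a.2, SimpleGraph.Reachable.refl _⟩⟩ ?_
  · have hb : b.1 ∈ S := b.2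
    exact (mem_filter.1 (this.ge hb)).2.2
  · intro x hx y hy hyn hadj
    rw [mem_filter] at hx hyn
    obtain ⟨hxS, hx', hr⟩ := hx
    refine hyn ⟨hy, hy, hr.trans (SimpleGraph.Adj.reachable ?_)⟩
    exact hadj

variable [DecidableEq V]

/-- Removing a part which is attached at a single vertex keeps a set linked. -/
theorem Linked.sdiff {S X : Finset V} {u : V} (h : Linked G S) (hX : X ⊆ S) (hu : u ∈ S)
    (huX : u ∉ X) (hcl : ∀ x ∈ X, ∀ y ∈ S, y ∉ X → y ≠ u → ¬ G.Adj x y) : Linked G (S \ X) := by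
  intro P hP hne hPcl
  by_cases huP : u ∈ P
  · have hU : P ∪ X = S := by
      refine h _ (union_subset (hP.trans sdiff_subset) hX) (hne.mono subset_union_left) ?_
      intro x hx y hy hyn
      rw [mem_union, not_or] at hyn
      rcases mem_union.1 hx with hx | hx
      · exact hPcl x hx y (mem_sdiff.2 ⟨hy, hyn.2⟩) hyn.1
      · exact hcl x hx y hy hyn.2 (by rintro rfl; exact hyn.1 huP)
    refine Subset.antisymm hP fun y hy => ?_
    rw [mem_sdiff, ← hU, mem_union] at hy
    tauto
  · have hU : P = S := by
      refine h _ (hP.trans sdiff_subset) hne ?_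
      intro x hx y hy hyn hadj
      by_cases hyX : y ∈ X
      · have hx' := mem_sdiff.1 (hP hx)
        exact hcl y hyX x hx'.1 hx'.2 (by rintro rfl; exact huP hx) hadj.symm
      · exact hPcl x hx y (mem_sdiff.2 ⟨hy, hyX⟩) hyn hadj
    exact absurd (hU ▸ hu) huP

/-- Distance from `w` changes by at most one along an edge, so a path in `S` from `w` to `y` meets
level `i`. If that level had at most one vertex, deleting it would leave `w` and `y` unconnected
inside `S`. The distances are those of `G`, which makes no difference to this argument. -/
theorem two_le_card_level (hG : G.Connected) {S : Finset V} {w : V} (hw : w ∈ S)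
    (hS : Linked G S) (hz : ∀ z ∈ S, z ≠ w → Linked G (S.erase z)) {i : ℕ} (hi : 1 ≤ i)
    {y : V} (hy : y ∈ S) (hiy : i < G.dist w y) : 2 ≤ #{x ∈ S | G.dist w x = i} := by
  by_contra! hlt
  have key : ∀ T ⊆ S, w ∈ T → y ∈ T → Linked G T → (∀ x ∈ T, G.dist w x ≠ i) → False := by
    intro T hTS hwT hyT hT hno
    have := hT {x ∈ T | G.dist w x < i} (filter_subset _ _) ⟨w, by simp [hwT]; omega⟩ ?_
    · rw [← this, mem_filter] at hyT
      omega
    · intro a ha b hb hbn hab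
      rw [mem_filter] at ha hbn
      have h1 := dist_le_dist_add_one hG w hab
      have h2 := hno b hb
      have h3 : ¬ G.dist w b < i := fun h => hbn ⟨hb, h⟩
      omega
  rcases ({x ∈ S | G.dist w x = i}).eq_empty_or_nonempty with h0 | ⟨z, hzm⟩
  · refine key S Subset.rfl hw hy hS fun x hx hxi => ?_
    have : x ∈ ({x ∈ S | G.dist w x = i}) := mem_filter.2 ⟨hx, hxi⟩
    simp [h0] at this
  · have hone : ∀ x ∈ S, G.dist w x = i → x = z := fun x hx hxi =>
      card_le_one.1 (by omega) x (mem_filter.2 ⟨hx, hxi⟩) z hzm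
    rw [mem_filter] at hzm
    have hzw : z ≠ w := by
      rintro rfl
      simp at hzm
      omega
    refine key (S.erase z) (erase_subset _ _) (mem_erase.2 ⟨hzw.symm, hw⟩)
      (mem_erase.2 ⟨by rintro rfl; omega, hy⟩) (hz z hzm.1 hzw) fun x hx hxi => ?_
    exact (mem_erase.1 hx).1 (hone x (mem_erase.1 hx).2 hxi)

theorem card_near_ge (hG : G.Connected) {S : Finset V} {w : V} (hw : w ∈ S)
    (hS : Linked G S) (hz : ∀ z ∈ S, z ≠ w → Linked G (S.erase z)) (i : ℕ)
    {y : V} (hy : y ∈ S) (hiy : i < G.dist w y) : 1 + 2 * i ≤ #{x ∈ S | G.dist w x ≤ i} := by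
  induction i with
  | zero => exact card_pos.2 ⟨w, by simp [hw]⟩
  | succ i ih =>
    have h1 := ih (by omega)
    have h2 := two_le_card_level hG hw hS hz (Nat.le_add_left 1 i) hy hiy
    have h3 : #{x ∈ S | G.dist w x ≤ i + 1} =
        #{x ∈ S | G.dist w x ≤ i} + #{x ∈ S | G.dist w x = i + 1} := by
      rw [← card_union_of_disjoint, ← filter_or]
      · congr 1
        ext x
        simp only [mem_filter]
        exact and_congr_right fun _ => by omega
      · rw [disjoint_filter]
        intro x _ h
        omega
    omega

theorem card_far_le (hG : G.Connected) {S : Finset V} {w : V} (hw : w ∈ S)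
    (hS : Linked G S) (hz : ∀ z ∈ S, z ≠ w → Linked G (S.erase z)) (i : ℕ) :
    #{x ∈ S | i < G.dist w x} ≤ #S - 1 - 2 * i := by
  rcases ({x ∈ S | i < G.dist w x}).eq_empty_or_nonempty with h0 | ⟨y, hy⟩
  · simp [h0]
  · rw [mem_filter] at hy
    have h1 := card_near_ge hG hw hS hz i hy.1 hy.2
    have h2 := card_filter_add_card_filter_not (s := S) (fun x => G.dist w x ≤ i)
    simp only [not_le] at h2
    omega

theorem dist_le_half_card (hG : G.Connected) {S : Finset V} {w : V} (hw : w ∈ S)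
    (hS : Linked G S) (hz : ∀ z ∈ S, z ≠ w → Linked G (S.erase z)) {y : V} (hy : y ∈ S) :
    G.dist w y ≤ #S / 2 := by
  by_contra! h
  have h1 := card_far_le hG hw hS hz (#S / 2)
  have h2 : 0 < #{x ∈ S | #S / 2 < G.dist w x} := card_pos.2 ⟨y, mem_filter.2 ⟨hy, h⟩⟩
  omega

theorem distSum_le (hG : G.Connected) {S : Finset V} {w : V} (hw : w ∈ S)
    (hS : Linked G S) (hz : ∀ z ∈ S, z ≠ w → Linked G (S.erase z)) :
    distSum G S w ≤ #S ^ 2 / 4 := by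
  rw [← sum_range_sub_two_mul, distSum_eq_sum_card (N := #S) fun y hy =>
    (dist_le_half_card hG hw hS hz hy).trans (Nat.div_le_self _ _)]
  exact sum_le_sum fun i _ => card_far_le hG hw hS hz i

/-- In a set of maximal distance sum, the root has exactly two neighbours. -/
theorem card_adj_of_distSum_eq (hG : G.Connected) {S : Finset V} {w : V} (hw : w ∈ S)
    (hS : Linked G S) (hz : ∀ z ∈ S, z ≠ w → Linked G (S.erase z)) (h3 : 3 ≤ #S)
    (heq : distSum G S w = #S ^ 2 / 4) : #{x ∈ S | G.dist w x = 1} = 2 := by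
  rw [← sum_range_sub_two_mul, distSum_eq_sum_card (N := #S) fun y hy =>
    (dist_le_half_card hG hw hS hz hy).trans (Nat.div_le_self _ _),
    sum_eq_sum_iff_of_le fun i _ => card_far_le hG hw hS hz i] at heq
  -- Termwise equality gives `#S - 1` vertices beyond level 0 and `#S - 3` beyond level 1; the
  -- difference is level 1.
  have h0 := heq 0 (mem_range.2 (by omega))
  have h1 := heq 1 (mem_range.2 (by omega))
  have h2 : #{x ∈ S | 0 < G.dist w x} =
      #{x ∈ S | 1 < G.dist w x} + #{x ∈ S | G.dist w x = 1} := by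
    rw [← card_union_of_disjoint, ← filter_or]
    · congr 1
      ext x
      simp only [mem_filter]
      exact and_congr_right fun _ => by omega
    · rw [disjoint_filter]
      intro x _ h
      omega
  omega

/-! ### Gluing two vertex sets at one vertex. -/

/-- All edges which leave `S` leave it from the vertex `u`. -/
def Gate (G : SimpleGraph V) (u : V) (S : Finset V) : Prop :=
  ∀ x ∈ S, x ≠ u → ∀ y, y ∉ S → ¬ G.Adj x y

/-- A walk starting in `S` stays in `S` until it reaches `u`, so a shortest walk to the outside
passes through `u`. -/
theorem Gate.dist_eq (hG : G.Connected) {S : Finset V} {u : V} (h : Gate G u S) {x y : V}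
    (hx : x ∈ S) (hy : y ∉ S ∨ y = u) : G.dist x y = G.dist x u + G.dist u y := by
  refine le_antisymm hG.dist_triangle ?_
  obtain ⟨p, hp⟩ := hG.exists_walk_length_eq_dist x y
  rw [← hp]
  clear hp
  induction p with
  | nil =>
    rcases hy with hy | rfl
    · exact absurd hx hy
    · simp
  | @cons x z y hxz p ih =>
    by_cases hxu : x = u
    · subst hxu
      simpa using SimpleGraph.dist_le (SimpleGraph.Walk.cons hxz p)
    · have hz : z ∈ S := by
        by_contra hz
        exact h x hx hxu z hz hxz
      have h1 := ih hz hy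
      have h2 := dist_le_dist_add_one hG u hxz.symm
      rw [SimpleGraph.Walk.length_cons, G.dist_comm (u := x) (v := u)]
      rw [G.dist_comm (u := z) (v := u)] at h1
      omega

theorem Gate.distSum_eq (hG : G.Connected) {S T : Finset V} {u : V} (h : Gate G u S)
    (hST : S ∩ T = {u}) {x : V} (hx : x ∈ S) :
    distSum G T x = #T * G.dist x u + distSum G T u := by
  have : ∀ y ∈ T, G.dist x y = G.dist x u + G.dist u y := fun y hy => by
    refine h.dist_eq hG hx ?_
    by_cases hyS : y ∈ S
    · right
      simpa [hST] using mem_inter.2 ⟨hyS, hy⟩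
    · exact Or.inl hyS
  rw [distSum, sum_congr rfl this, sum_add_distrib, sum_const, smul_eq_mul, distSum]

theorem distSum_union {S T : Finset V} {u : V} (hST : S ∩ T = {u}) (x : V) :
    distSum G (S ∪ T) x + G.dist x u = distSum G S x + distSum G T x := by
  have := sum_union_inter (s₁ := S) (s₂ := T) (f := fun y => G.dist x y)
  rw [hST, sum_singleton] at this
  exact this

theorem distSum_union_self {S T : Finset V} {u : V} (hST : S ∩ T = {u}) :
    distSum G (S ∪ T) u = distSum G S u + distSum G T u := by
  simpa using distSum_union (G := G) hST u

/-- Distances between `S` and `T` split at `u`. The terms added on the left compensate for counting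
`u` in both sets and avoid natural subtraction. -/
theorem Gate.pairSum_union (hG : G.Connected) {S T : Finset V} {u : V} (h : Gate G u S)
    (hST : S ∩ T = {u}) :
    pairSum G (S ∪ T) + 2 * distSum G S u + 2 * distSum G T u =
      pairSum G S + pairSum G T + 2 * (#S * distSum G T u) + 2 * (#T * distSum G S u) := by
  have hS : ∑ x ∈ S, distSum G T x = #T * distSum G S u + #S * distSum G T u := by
    rw [sum_congr rfl fun x hx => h.distSum_eq hG hST hx, sum_add_distrib, ← mul_sum, sum_const,
      smul_eq_mul]
    simp only [distSum, G.dist_comm (v := u)]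
  have hT : ∑ x ∈ T, distSum G S x = #T * distSum G S u + #S * distSum G T u := by
    rw [← hS]
    simp only [distSum]
    rw [sum_comm]
    simp only [G.dist_comm]
  have h1 : ∑ x ∈ S, (distSum G (S ∪ T) x + G.dist x u) =
      ∑ x ∈ S, (distSum G S x + distSum G T x) :=
    sum_congr rfl fun x _ => distSum_union hST x
  have h2 : ∑ x ∈ T, (distSum G (S ∪ T) x + G.dist x u) =
      ∑ x ∈ T, (distSum G S x + distSum G T x) :=
    sum_congr rfl fun x _ => distSum_union hST x
  have h3 := sum_union_inter (s₁ := S) (s₂ := T) (f := fun x => distSum G (S ∪ T) x)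
  rw [hST, sum_singleton, distSum_union_self hST] at h3
  rw [sum_add_distrib, sum_add_distrib, hS] at h1
  rw [sum_add_distrib, sum_add_distrib, hT] at h2
  have h4 : ∀ R : Finset V, ∑ x ∈ R, G.dist x u = distSum G R u := fun R => by
    simp only [distSum, G.dist_comm (v := u)]
  rw [h4] at h1 h2
  simp only [pairSum]
  omega

end LevelSets

/-! ### Numerical bounds, and unions of blocks at a vertex. -/

section Stars

theorem exists_sq_div_four_eq (k : ℕ) :
    (∃ p, k = 2 * p ∧ k ^ 2 / 4 = p ^ 2) ∨ ∃ p, k = 2 * p + 1 ∧ k ^ 2 / 4 = p ^ 2 + p := by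
  obtain ⟨p, hp | hp⟩ := Nat.even_or_odd' k
  · refine Or.inl ⟨p, hp, ?_⟩
    rw [hp, show (2 * p) ^ 2 = 4 * p ^ 2 by ring]
    omega
  · refine Or.inr ⟨p, hp, ?_⟩
    rw [hp, show (2 * p + 1) ^ 2 = 4 * (p ^ 2 + p) + 1 by ring]
    omega

/-- The arithmetic of the induction in `Star.bound`: parts with `a + 2` and `b + 2` vertices share
one vertex, and `s + 2` vertices lie outside both. The summand 2 is the excess of the path on three
vertices rooted at its centre, whose ordered distance sum is 8 instead of 3 · t(3) = 6. The
inequality has room for an extra 1 unless both parts are edges. -/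
theorem split_bound (a b s : ℕ) :
    (a + 2) * ((a + 2) ^ 2 / 4) + 2 * ((s + 2 + (b + 1)) * ((a + 2) ^ 2 / 4)) +
      (if a + 2 = 3 then 2 else 0) +
      ((b + 2) * ((b + 2) ^ 2 / 4) + 2 * ((s + 2 + (a + 1)) * ((b + 2) ^ 2 / 4)) +
      (if b + 2 = 3 then 2 else 0)) + (if a + b + 3 = 3 then 0 else 1) ≤
    (a + b + 3) * ((a + b + 3) ^ 2 / 4) + 2 * ((s + 2) * ((a + b + 3) ^ 2 / 4)) +
      (if a + b + 3 = 3 then 2 else 0) := by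
  rcases exists_sq_div_four_eq (a + 2) with ⟨p, hp, hp'⟩ | ⟨p, hp, hp'⟩ <;>
  rcases exists_sq_div_four_eq (b + 2) with ⟨q, hq, hq'⟩ | ⟨q, hq, hq'⟩ <;>
  rcases exists_sq_div_four_eq (a + b + 3) with ⟨r, hr, hr'⟩ | ⟨r, hr, hr'⟩ <;>
  first
  | exfalso; omega
  | rw [hp', hq', hr']
    obtain ⟨p, rfl⟩ : ∃ p', p = p' + 1 := ⟨p - 1, by omega⟩
    obtain ⟨q, rfl⟩ : ∃ q', q = q' + 1 := ⟨q - 1, by omega⟩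
    rcases (by omega : r = p + q + 1 ∨ r = p + q + 2) with rfl | rfl <;>
    rcases (by omega : a = 2 * p ∨ a = 2 * p + 1) with rfl | rfl <;>
    rcases (by omega : b = 2 * q ∨ b = 2 * q + 1) with rfl | rfl <;>
    first
    | exfalso; omega
    | skip
    clear hp hp' hq hq' hr hr'
    rcases p with _ | p <;> rcases q with _ | q <;> split_ifs <;>
    first
    | omega
    | nlinarith [Nat.zero_le (p * q), Nat.zero_le (p * q * s), Nat.zero_le (p ^ 2 * q),
        Nat.zero_le (q ^ 2 * p), Nat.zero_le (p * s), Nat.zero_le (q * s), Nat.zero_le (p ^ 2),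
        Nat.zero_le (q ^ 2)]
    | nlinarith [Nat.zero_le (p * s), Nat.zero_le (p ^ 2)]
    | nlinarith [Nat.zero_le (q * s), Nat.zero_le (q ^ 2)]

/-- Bound for twice the Wiener index of two pieces with `x + 2` and `y + 2` vertices which are
joined by a block with `z + 2` vertices. -/
def twoCutBound (x y z : ℕ) : ℕ :=
  (x + 2) * ((x + 2) ^ 2 / 4) + 2 * ((y + z + 2) * ((x + 2) ^ 2 / 4)) +
    (if x + 2 = 3 then 2 else 0) +
  ((y + 2) * ((y + 2) ^ 2 / 4) + 2 * ((x + z + 2) * ((y + 2) ^ 2 / 4)) +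
    (if y + 2 = 3 then 2 else 0)) +
  ((z + 2) * ((z + 2) ^ 2 / 4) + 2 * ((x + 1 + (y + 1)) * ((z + 2) ^ 2 / 4))) +
  2 * ((x + 1) * (y + 1) * ((z + 2) / 2))

/-- Twice the Wiener index of the cycle on `m` vertices with a pendant path of length two. -/
def lollipopValue (m : ℕ) : ℕ := m * (m ^ 2 / 4) + 4 * (m ^ 2 / 4) + 6 * m + 2

theorem twoCutBound_comm (x y z : ℕ) : twoCutBound x y z = twoCutBound y x z := by
  unfold twoCutBound
  ring

theorem twoCutBound_extreme {x : ℕ} (hx : x ≠ 1) :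
    twoCutBound x 0 0 = lollipopValue (x + 2) := by
  unfold twoCutBound lollipopValue
  rw [if_neg (by omega), if_neg (by omega)]
  norm_num
  ring

/-- This is four times the inequality of `twoCutBound_lt` after the floors are estimated and each
exceptional summand is replaced by 2. These losses matter for smaller sums: the inequality fails at
(1, 7, 0), so the sums 6, 7 and 8 are checked separately. -/
theorem cubic_bound {x y z : ℕ} (h : 9 ≤ x + y + z) (hne : z ≠ 0 ∨ (x ≠ 0 ∧ y ≠ 0)) :
    4 * (x * y) + x + y + 22 <
      x ^ 2 * y + x ^ 2 * z + y ^ 2 * x + y ^ 2 * z + z ^ 2 * x + z ^ 2 * y + 2 * (x * y * z) +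
        3 * z := by
  have aux : ∀ a b : ℕ, 9 ≤ a + 1 + (b + 1) →
      9 * ((a + 1) * (b + 1)) ≤ (a + 1) * (b + 1) * (a + 1 + (b + 1)) := fun a b h => by
    rw [mul_comm 9]
    exact Nat.mul_le_mul_left _ h
  rcases z with _ | z
  · obtain ⟨x, rfl⟩ : ∃ x', x = x' + 1 := ⟨x - 1, by omega⟩
    obtain ⟨y, rfl⟩ : ∃ y', y = y' + 1 := ⟨y - 1, by omega⟩
    have := aux x y (by omega)
    nlinarith [Nat.zero_le (x * y)]
  · rcases x with _ | x
    · rcases y with _ | y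
      · omega
      · have := aux y z (by omega)
        nlinarith [Nat.zero_le (y * z)]
    · rcases y with _ | y
      · have := aux x z (by omega)
        nlinarith [Nat.zero_le (x * z)]
      · have h1 : 9 * ((x + 1) * (y + 1) + (x + 1) * (z + 1) + (y + 1) * (z + 1)) ≤
            ((x + 1) * (y + 1) + (x + 1) * (z + 1) + (y + 1) * (z + 1)) *
              (x + 1 + (y + 1) + (z + 1)) := by
          rw [mul_comm 9]
          exact Nat.mul_le_mul_left _ h
        nlinarith [Nat.zero_le (x * z), Nat.zero_le (x * y), Nat.zero_le (y * z),
          Nat.zero_le (x * y * z), h1]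

theorem twoCutBound_lt_small : ∀ x y z : Fin 9,
    6 ≤ x.1 + y.1 + z.1 ∧ x.1 + y.1 + z.1 ≤ 8 ∧ (z.1 ≠ 0 ∨ (x.1 ≠ 0 ∧ y.1 ≠ 0)) →
    twoCutBound x.1 y.1 z.1 < lollipopValue (x.1 + y.1 + z.1 + 2) := by
  decide +kernel

/-- Here n = x + y + z + 4, so the threshold 6 is n ≥ 10. It is sharp: for n = 9 both `twoCutBound 1
4 0` and `lollipopValue 7` are 176. -/
theorem twoCutBound_lt {x y z : ℕ} (h : 6 ≤ x + y + z) (hne : z ≠ 0 ∨ (x ≠ 0 ∧ y ≠ 0)) :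
    twoCutBound x y z < lollipopValue (x + y + z + 2) := by
  rcases le_or_gt (x + y + z) 8 with h8 | h8
  · exact twoCutBound_lt_small ⟨x, by omega⟩ ⟨y, by omega⟩ ⟨z, by omega⟩ ⟨h, h8, hne⟩
  have key := cubic_bound h8 hne
  unfold twoCutBound lollipopValue
  have ht : ∀ k : ℕ, 4 * (k ^ 2 / 4) ≤ k ^ 2 := fun k => Nat.mul_div_le _ _
  have hm : (x + y + z + 2) ^ 2 ≤ 4 * ((x + y + z + 2) ^ 2 / 4) + 1 := by
    rcases exists_sq_div_four_eq (x + y + z + 2) with ⟨r, hr, hr'⟩ | ⟨r, hr, hr'⟩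
    · rw [hr', hr]
      nlinarith
    · rw [hr', hr]
      nlinarith
  have hx := Nat.mul_le_mul_left (x + 2 + 2 * (y + z + 2)) (ht (x + 2))
  have hy := Nat.mul_le_mul_left (y + 2 + 2 * (x + z + 2)) (ht (y + 2))
  have hz := Nat.mul_le_mul_left (z + 2 + 2 * (x + 1 + (y + 1))) (ht (z + 2))
  have hd := Nat.mul_le_mul_left ((x + 1) * (y + 1)) (Nat.mul_div_le (z + 2) 2)
  have hT := Nat.mul_le_mul_left (x + y + z + 2 + 4) hm
  have e1 : (if x + 2 = 3 then 2 else 0) ≤ 2 := by split_ifs <;> omega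
  have e2 : (if y + 2 = 3 then 2 else 0) ≤ 2 := by split_ifs <;> omega
  generalize (if x + 2 = 3 then 2 else 0) = ex at *
  generalize (if y + 2 = 3 then 2 else 0) = ey at *
  generalize (x + 2) ^ 2 / 4 = tx at *
  generalize (y + 2) ^ 2 / 4 = ty at *
  generalize (z + 2) ^ 2 / 4 = tz at *
  generalize (z + 2) / 2 = d at *
  generalize (x + y + z + 2) ^ 2 / 4 = tm at *
  ring_nf at *
  linarith

variable {V : Type*} [DecidableEq V] {G : SimpleGraph V}

/-- `S` is a union of blocks at `u`: it is linked, its edges to the outside start at `u`, and no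
vertex of `S` other than `u` separates `S`. -/
structure Star (G : SimpleGraph V) (u : V) (S : Finset V) : Prop where
  mem : u ∈ S
  linked : Linked G S
  linked_erase : ∀ z ∈ S, z ≠ u → Linked G (S.erase z)
  gate : Gate G u S

theorem Star.sdiff {u : V} {S X : Finset V} (h : Star G u S) (hX : X ⊆ S.erase u)
    (hcl : ∀ x ∈ X, ∀ y ∈ S, y ∉ X → y ≠ u → ¬ G.Adj x y) : Star G u (S \ X) := by
  have huX : u ∉ X := fun hu => (mem_erase.1 (hX hu)).1 rfl
  have hXS : X ⊆ S := hX.trans (erase_subset _ _)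
  refine ⟨mem_sdiff.2 ⟨h.mem, huX⟩, h.linked.sdiff hXS h.mem huX hcl, ?_, ?_⟩
  · intro z hz hzu
    rw [mem_sdiff] at hz
    rw [← erase_sdiff_comm]
    refine (h.linked_erase z hz.1 hzu).sdiff (fun x hx => mem_erase.2 ⟨?_, hXS hx⟩)
      (mem_erase.2 ⟨hzu.symm, h.mem⟩) huX fun x hx y hy => hcl x hx y (mem_erase.1 hy).2
    rintro rfl
    exact hz.2 hx
  · intro x hx hxu y hy hadj
    rw [mem_sdiff] at hx hy
    by_cases hyS : y ∈ S
    · have hyX : y ∈ X := by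
        by_contra hyX
        exact hy ⟨hyS, hyX⟩
      exact hcl y hyX x hx.1 hx.2 hxu hadj.symm
    · exact h.gate x hx.1 hxu y hyS hadj

theorem exists_part_of_not_linked {S : Finset V} (h : ¬ Linked G S) :
    ∃ P ⊆ S, P.Nonempty ∧ (S \ P).Nonempty ∧ ∀ x ∈ P, ∀ y ∈ S, y ∉ P → ¬ G.Adj x y := by
  unfold Linked at h
  push Not at h
  obtain ⟨P, hP, hne, hcl, hPS⟩ := h
  refine ⟨P, hP, hne, ?_, hcl⟩
  rw [sdiff_nonempty]
  exact fun h => hPS (hP.antisymm h)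

/-- If `u` separates `S`, the components of `S` without `u` fall into two nonempty classes; each of
them together with `u` is again a star. -/
theorem Star.exists_split {u : V} {S : Finset V} (h : Star G u S)
    (hu : ¬ Linked G (S.erase u)) :
    ∃ S₁ S₂, Star G u S₁ ∧ Star G u S₂ ∧ S₁ ∪ S₂ = S ∧ S₁ ∩ S₂ = {u} ∧ 2 ≤ #S₁ ∧ 2 ≤ #S₂ := by
  obtain ⟨P, hP, ⟨p, hp⟩, ⟨q, hq⟩, hcl⟩ := exists_part_of_not_linked hu
  have huP : u ∉ P := fun hu => (mem_erase.1 (hP hu)).1 rfl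
  have hq' := mem_sdiff.1 hq
  have hq'' := mem_erase.1 hq'.1
  have hp' := mem_erase.1 (hP hp)
  refine ⟨S \ (S.erase u \ P), S \ P, h.sdiff sdiff_subset ?_, h.sdiff hP ?_, ?_, ?_, ?_, ?_⟩
  · intro x hx y hy hyn hyu hadj
    rw [mem_sdiff] at hx hyn
    have hyP : y ∈ P := by
      by_contra hyP
      exact hyn ⟨mem_erase.2 ⟨hyu, hy⟩, hyP⟩
    exact hcl y hyP x hx.1 hx.2 hadj.symm
  · exact fun x hx y hy hyn hyu => hcl x hx y (mem_erase.2 ⟨hyu, hy⟩) hyn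
  · ext x
    simp only [mem_union, mem_sdiff, mem_erase]
    tauto
  · ext x
    simp only [mem_inter, mem_sdiff, mem_erase, mem_singleton]
    constructor
    · tauto
    · rintro rfl
      exact ⟨⟨h.mem, by tauto⟩, h.mem, huP⟩
  · refine one_lt_card.2 ⟨u, ?_, p, ?_, hp'.1.symm⟩
    · simp [h.mem]
    · simp [hp'.2, hp]
  · refine one_lt_card.2 ⟨u, ?_, q, ?_, hq''.1.symm⟩
    · simp [h.mem, huP]
    · simp [hq''.2, hq'.2]

theorem Star.distSum_le (hG : G.Connected) {u : V} {S : Finset V} (h : Star G u S) :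
    distSum G S u ≤ #S ^ 2 / 4 :=
  WienerCut.distSum_le hG h.mem h.linked h.linked_erase

theorem pairSum_le (hG : G.Connected) {S : Finset V} (h : Linked G S)
    (hz : ∀ z ∈ S, Linked G (S.erase z)) : pairSum G S ≤ #S * (#S ^ 2 / 4) := by
  rw [← smul_eq_mul]
  exact sum_le_card_nsmul _ _ _ fun w hw => distSum_le hG hw h fun z hzS _ => hz z hzS

theorem Star.linked_erase_all {u : V} {S : Finset V} (h : Star G u S)
    (hu : Linked G (S.erase u)) : ∀ z ∈ S, Linked G (S.erase z) := by
  intro z hz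
  by_cases hzu : z = u
  · rwa [hzu]
  · exact h.linked_erase z hz hzu

/-- Either `S` is a block, or it satisfies a bound which is smaller than that of a block, up to
an exception for paths on three vertices. -/
theorem Star.bound (hG : G.Connected) {u : V} (N : ℕ) : ∀ {S : Finset V} (_ : Star G u S)
    (_ : #S ≤ N) (_ : 2 ≤ #S) {s : ℕ} (_ : 2 ≤ s),
    (Linked G (S.erase u) ∨ pairSum G S + 2 * (s * distSum G S u) + (if #S = 3 then 0 else 1) ≤
        #S * (#S ^ 2 / 4) + 2 * (s * (#S ^ 2 / 4)) + (if #S = 3 then 2 else 0)) ∧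
      pairSum G S + 2 * (s * distSum G S u) ≤
        #S * (#S ^ 2 / 4) + 2 * (s * (#S ^ 2 / 4)) + (if #S = 3 then 2 else 0) := by
  induction N with
  | zero => intros; omega
  | succ N ih =>
    intro S h hN h2 s hs
    by_cases hu : Linked G (S.erase u)
    · refine ⟨Or.inl hu, ?_⟩
      have h1 := pairSum_le hG h.linked (h.linked_erase_all hu)
      have h3 := Nat.mul_le_mul_left s (h.distSum_le hG)
      omega
    · obtain ⟨S₁, S₂, hS₁, hS₂, hU, hI, hc₁, hc₂⟩ := h.exists_split hu
      have hcard := card_union_add_card_inter S₁ S₂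
      rw [hU, hI, card_singleton] at hcard
      have hglue := hS₁.gate.pairSum_union hG hI
      have hD := distSum_union_self (G := G) hI
      rw [hU] at hglue hD
      obtain ⟨a, ha⟩ : ∃ a, #S₁ = a + 2 := ⟨#S₁ - 2, by omega⟩
      obtain ⟨b, hb⟩ : ∃ b, #S₂ = b + 2 := ⟨#S₂ - 2, by omega⟩
      obtain ⟨s, rfl⟩ : ∃ s', s = s' + 2 := ⟨s - 2, by omega⟩
      have hSc : #S = a + b + 3 := by omega
      have i₁ := (ih hS₁ (by omega) hc₁ (s := s + 2 + (b + 1)) (by omega)).2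
      have i₂ := (ih hS₂ (by omega) hc₂ (s := s + 2 + (a + 1)) (by omega)).2
      have hnum := split_bound a b s
      rw [hSc, hD]
      rw [ha] at i₁ hglue
      rw [hb] at i₂ hglue
      suffices hst : pairSum G S + 2 * ((s + 2) * (distSum G S₁ u + distSum G S₂ u)) +
          (if a + b + 3 = 3 then 0 else 1) ≤ (a + b + 3) * ((a + b + 3) ^ 2 / 4) +
          2 * ((s + 2) * ((a + b + 3) ^ 2 / 4)) + (if a + b + 3 = 3 then 2 else 0) from
        ⟨Or.inr hst, le_trans (Nat.le_add_right _ _) hst⟩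
      refine le_trans ?_ hnum
      refine Nat.add_le_add_right ?_ _
      refine le_trans ?_ (Nat.add_le_add i₁ i₂)
      nlinarith [hglue]

end Stars

/-! ### The decomposition at two cut vertices. -/

section TwoCutVertices

variable {V : Type*} {G : SimpleGraph V} [Fintype V]

open Classical in
/-- The vertices which are separated from `v` by the vertex `u`. -/
noncomputable def farSide (G : SimpleGraph V) (u v : V) : Finset V :=
  {x | ∃ P : Finset V, x ∈ P ∧ u ∉ P ∧ v ∉ P ∧ ∀ a ∈ P, ∀ b, b ∉ P → b ≠ u → ¬ G.Adj a b}

theorem mem_farSide {u v x : V} : x ∈ farSide G u v ↔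
    ∃ P : Finset V, x ∈ P ∧ u ∉ P ∧ v ∉ P ∧ ∀ a ∈ P, ∀ b, b ∉ P → b ≠ u → ¬ G.Adj a b := by
  simp [farSide]

theorem notMem_farSide_left (u v : V) : u ∉ farSide G u v := fun h =>
  let ⟨_, h1, h2, _⟩ := mem_farSide.1 h
  h2 h1

theorem notMem_farSide_right (u v : V) : v ∉ farSide G u v := fun h =>
  let ⟨_, h1, _, h2, _⟩ := mem_farSide.1 h
  h2 h1

theorem farSide_closed {u v x y : V} (hx : x ∈ farSide G u v) (hy : y ∉ farSide G u v)
    (hyu : y ≠ u) : ¬ G.Adj x y := by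
  obtain ⟨P, hxP, hu, hv, hcl⟩ := mem_farSide.1 hx
  exact hcl x hxP y (fun h => hy (mem_farSide.2 ⟨P, h, hu, hv, hcl⟩)) hyu

variable [DecidableEq V]

theorem farSide_nonempty {u v : V} (h : ¬ Linked G (univ.erase u)) :
    (farSide G u v).Nonempty := by
  obtain ⟨P, hP, ⟨p, hp⟩, ⟨q, hq⟩, hcl⟩ := exists_part_of_not_linked h
  by_cases hv : v ∈ P
  · refine ⟨q, mem_farSide.2 ⟨univ.erase u \ P, hq, by simp, by simp [hv], ?_⟩⟩
    intro a ha b hb hbu hadj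
    rw [mem_sdiff] at ha hb
    have hbP : b ∈ P := by
      by_contra hbP
      exact hb ⟨mem_erase.2 ⟨hbu, mem_univ _⟩, hbP⟩
    exact hcl b hbP a ha.1 ha.2 hadj.symm
  · refine ⟨p, mem_farSide.2 ⟨P, hp, fun hu => (mem_erase.1 (hP hu)).1 rfl, hv, ?_⟩⟩
    exact fun a ha b hb hbu => hcl a ha b (mem_erase.2 ⟨hbu, mem_univ _⟩) hb

/-- Of a closed proper part and its complement, one avoids `v`, and it would then belong to the far
side. So this set is the component of `v` after deleting `u`. -/
theorem linked_nearSide (u v : V) : Linked G (univ.erase u \ farSide G u v) := by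
  intro P hP hne hcl
  by_contra hPS
  obtain ⟨q, hq, hqP⟩ := exists_of_ssubset (hP.ssubset_of_ne hPS)
  obtain ⟨p, hp⟩ := hne
  by_cases hv : v ∈ P
  · refine (mem_sdiff.1 hq).2 (mem_farSide.2
      ⟨(univ.erase u \ farSide G u v) \ P, mem_sdiff.2 ⟨hq, hqP⟩, by simp, by simp [hv], ?_⟩)
    intro a ha b hb hbu hadj
    rw [mem_sdiff] at ha
    have ha1 := mem_sdiff.1 ha.1
    by_cases hbf : b ∈ farSide G u v
    · exact farSide_closed hbf ha1.2 (mem_erase.1 ha1.1).1 hadj.symm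
    · have hbS : b ∈ univ.erase u \ farSide G u v :=
        mem_sdiff.2 ⟨mem_erase.2 ⟨hbu, mem_univ _⟩, hbf⟩
      by_cases hbP : b ∈ P
      · exact hcl b hbP a ha.1 ha.2 hadj.symm
      · exact hb (mem_sdiff.2 ⟨hbS, hbP⟩)
  · refine (mem_sdiff.1 (hP hp)).2 (mem_farSide.2 ⟨P, hp, ?_, hv, ?_⟩)
    · exact fun hu => by simpa using hP hu
    · intro a ha b hb hbu hadj
      have ha1 := mem_sdiff.1 (hP ha)
      by_cases hbf : b ∈ farSide G u v
      · exact farSide_closed hbf ha1.2 (mem_erase.1 ha1.1).1 hadj.symm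
      · exact hcl a ha b (mem_sdiff.2 ⟨mem_erase.2 ⟨hbu, mem_univ _⟩, hbf⟩) hb hadj

/-- If a set is linked, then it stays so without the vertices separated from `v` by `u`. -/
theorem Linked.sdiff_farSide {S : Finset V} {u v : V} (h : Linked G S) (hu : u ∈ S)
    (hS : farSide G u v ⊆ S) : Linked G (S \ farSide G u v) :=
  h.sdiff hS hu (notMem_farSide_left u v) fun _ hx _ _ hy hyu => farSide_closed hx hy hyu

/-- The near side is attached to the rest only at `u`, so deleting it preserves linkedness, both of
the whole graph and of the graph without a far vertex `z`, which is not a cut vertex. -/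
theorem star_farSide (u v : V) (hlin : Linked G univ)
    (hz : ∀ z, z ≠ u → z ≠ v → Linked G (univ.erase z)) :
    Star G u (insert u (farSide G u v)) := by
  have hcompl : ∀ T : Finset V, univ.erase u \ farSide G u v ⊆ T → u ∈ T → Linked G T →
      Linked G (T \ (univ.erase u \ farSide G u v)) := by
    intro T hT huT hTl
    refine hTl.sdiff hT huT (by simp) fun x hx y _ hyn hyu hadj => ?_
    rw [mem_sdiff] at hx hyn
    have hyf : y ∈ farSide G u v := by
      by_contra hyf
      exact hyn ⟨mem_erase.2 ⟨hyu, mem_univ _⟩, hyf⟩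
    exact farSide_closed hyf hx.2 (mem_erase.1 hx.1).1 hadj.symm
  refine ⟨mem_insert_self _ _, ?_, ?_, ?_⟩
  · convert hcompl univ (subset_univ _) (mem_univ _) hlin using 1
    ext x
    simp only [mem_insert, mem_sdiff, mem_erase, mem_univ]
    tauto
  · intro z hzm hzu
    have hzf : z ∈ farSide G u v := (mem_insert.1 hzm).resolve_left hzu
    have hzv : z ≠ v := by
      rintro rfl
      exact notMem_farSide_right u z hzf
    convert hcompl (univ.erase z) ?_ (mem_erase.2 ⟨hzu.symm, mem_univ _⟩) (hz z hzu hzv) using 1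
    · ext x
      simp only [mem_insert, mem_sdiff, mem_erase, mem_univ]
      tauto
    · intro x hx
      refine mem_erase.2 ⟨?_, mem_univ _⟩
      rintro rfl
      exact (mem_sdiff.1 hx).2 hzf
  · intro x hx hxu y hy
    rw [mem_insert, not_or] at hy
    exact farSide_closed ((mem_insert.1 hx).resolve_left hxu) hy.2 hy.1

/-- No edge leaves the intersection: the only possible exits are `u` and `v`, and each is excluded
by the far side of the other. A nonempty intersection would be all of `G`, yet it misses `u`. -/
theorem disjoint_farSide {u v : V} (huv : u ≠ v) (hlin : Linked G univ) :
    Disjoint (farSide G u v) (farSide G v u) := by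
  rw [disjoint_iff_inter_eq_empty]
  by_contra hne
  have := hlin (farSide G u v ∩ farSide G v u) (subset_univ _) (nonempty_iff_ne_empty.2 hne) ?_
  · exact notMem_farSide_left u v (mem_inter.1 (this.ge (mem_univ u))).1
  · intro x hx y _ hy hadj
    rw [mem_inter] at hx hy
    by_cases hyu : y = u
    · subst hyu
      exact farSide_closed hx.2 (notMem_farSide_right v y) huv hadj
    · have h1 : y ∈ farSide G u v := by
        by_contra h1
        exact farSide_closed hx.1 h1 hyu hadj
      have h2 : y ∉ farSide G v u := fun h2 => hy ⟨h1, h2⟩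
      refine farSide_closed hx.2 h2 ?_ hadj
      rintro rfl
      exact notMem_farSide_right u y h1

/-- The decomposition of a graph with exactly two cut vertices `u` and `v`. -/
structure Decomposition (G : SimpleGraph V) (u v : V) (A M B : Finset V) : Prop where
  left : Star G u A
  right : Star G v B
  mem_left : u ∈ M
  mem_right : v ∈ M
  linked : Linked G M
  linked_erase : ∀ z ∈ M, Linked G (M.erase z)
  inter_left : A ∩ (B ∪ M) = {u}
  inter_right : B ∩ M = {v}
  union_eq : A ∪ (B ∪ M) = univ
  card_left : 2 ≤ #A
  card_right : 2 ≤ #B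
  ne : u ≠ v

/-- The middle part is what remains after both far sides are removed. -/
theorem exists_decomposition {u v : V} (huv : u ≠ v) (hlin : Linked G univ)
    (hu : ¬ Linked G (univ.erase u)) (hv : ¬ Linked G (univ.erase v))
    (hz : ∀ z, z ≠ u → z ≠ v → Linked G (univ.erase z)) :
    ∃ A M B, Decomposition G u v A M B := by
  have hdis := disjoint_farSide (G := G) (u := u) (v := v) huv hlin
  have hd : ∀ x, x ∈ farSide G u v → x ∉ farSide G v u := fun x hx => disjoint_left.1 hdis hx
  have h1 := notMem_farSide_left (G := G) u v
  have h2 := notMem_farSide_left (G := G) v u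
  have h3 := notMem_farSide_right (G := G) u v
  have h4 := notMem_farSide_right (G := G) v u
  have hcard : ∀ {x : V} {S : Finset V}, x ∉ S → S.Nonempty → 2 ≤ #(insert x S) := by
    intro x S hx hS
    rw [card_insert_of_notMem hx]
    have := hS.card_pos
    omega
  refine ⟨insert u (farSide G u v), (univ \ farSide G u v) \ farSide G v u,
    insert v (farSide G v u), star_farSide u v hlin hz,
    star_farSide v u hlin fun z h h' => hz z h' h, ?_, ?_, ?_, ?_, ?_, ?_, ?_,
    hcard h1 (farSide_nonempty hu), hcard h2 (farSide_nonempty hv), huv⟩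
  · simp [h1, h4]
  · simp [h2, h3]
  · refine (hlin.sdiff_farSide (mem_univ _) (subset_univ _)).sdiff_farSide (by simp [h3]) ?_
    exact fun x hx => by simpa using fun h => hd x h hx
  · intro z hzM
    simp only [mem_sdiff, mem_univ, true_and] at hzM
    rw [← erase_sdiff_comm, ← erase_sdiff_comm]
    -- Deleting a cut vertex from `G` itself is not allowed; instead the component of the other cut
    -- vertex is taken, and the other far side is removed from it.
    by_cases hzu : z = u
    · subst hzu
      refine (linked_nearSide z v).sdiff_farSide (by simp [h3, huv.symm]) ?_
      intro x hx
      simp only [mem_sdiff, mem_erase, mem_univ, and_true]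
      exact ⟨by rintro rfl; exact h4 hx, fun h => hd x h hx⟩
    · by_cases hzv : z = v
      · subst hzv
        rw [sdiff_right_comm]
        refine (linked_nearSide z u).sdiff_farSide (by simp [h4, huv]) ?_
        intro x hx
        simp only [mem_sdiff, mem_erase, mem_univ, and_true]
        exact ⟨by rintro rfl; exact h3 hx, fun h => hd x hx h⟩
      · refine ((hz z hzu hzv).sdiff_farSide (by simp [Ne.symm hzu]) ?_).sdiff_farSide
          (by simp [h3, Ne.symm hzv]) ?_
        · intro x hx
          simp only [mem_erase, mem_univ, and_true]
          rintro rfl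
          exact hzM.1 hx
        · intro x hx
          simp only [mem_sdiff, mem_erase, mem_univ, and_true]
          exact ⟨by rintro rfl; exact hzM.2 hx, fun h => hd x h hx⟩
  · ext x
    simp only [mem_inter, mem_union, mem_insert, mem_sdiff, mem_univ, true_and, mem_singleton]
    constructor
    · rintro ⟨rfl | hx, (rfl | hx') | hx'⟩
      · rfl
      · rfl
      · rfl
      · exact absurd hx h3
      · exact absurd hx' (hd x hx)
      · exact absurd hx hx'.1
    · rintro rfl
      exact ⟨Or.inl rfl, Or.inr ⟨h1, h4⟩⟩
  · ext x
    simp only [mem_inter, mem_insert, mem_sdiff, mem_univ, true_and, mem_singleton]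
    constructor
    · rintro ⟨rfl | hx, hx'⟩
      · rfl
      · exact absurd hx hx'.2
    · rintro rfl
      exact ⟨Or.inl rfl, h3, h2⟩
  · ext x
    simp only [mem_union, mem_insert, mem_sdiff, mem_univ, true_and, iff_true]
    tauto

theorem Decomposition.symm {u v : V} {A M B : Finset V} (h : Decomposition G u v A M B) :
    Decomposition G v u B M A := by
  have hl := fun x => Finset.ext_iff.1 h.inter_left x
  have hr := fun x => Finset.ext_iff.1 h.inter_right x
  have hU := fun x => Finset.ext_iff.1 h.union_eq x
  simp only [mem_inter, mem_union, mem_singleton, mem_univ, iff_true] at hl hr hU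
  refine ⟨h.right, h.left, h.mem_right, h.mem_left, h.linked, h.linked_erase, ?_, ?_, ?_,
    h.card_right, h.card_left, h.ne.symm⟩
  · ext x
    simp only [mem_inter, mem_union, mem_singleton]
    constructor
    · rintro ⟨hxB, hxA | hxM⟩
      · have hxu := (hl x).1 ⟨hxA, Or.inl hxB⟩
        exact (hr x).1 ⟨hxB, hxu ▸ h.mem_left⟩
      · exact (hr x).1 ⟨hxB, hxM⟩
    · intro hx
      have := (hr x).2 hx
      exact ⟨this.1, Or.inr this.2⟩
  · ext x
    simp only [mem_inter, mem_singleton]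
    constructor
    · rintro ⟨hxA, hxM⟩
      exact (hl x).1 ⟨hxA, Or.inr hxM⟩
    · rintro rfl
      exact ⟨h.left.mem, h.mem_left⟩
  · ext x
    have := hU x
    simp only [mem_union, mem_univ, iff_true]
    tauto

theorem Decomposition.card_eq {u v : V} {A M B : Finset V} (h : Decomposition G u v A M B) :
    #A + #M + #B = Fintype.card V + 2 := by
  have h1 := card_union_add_card_inter A (B ∪ M)
  have h2 := card_union_add_card_inter B M
  rw [h.union_eq, h.inter_left, card_singleton, card_univ] at h1
  rw [h.inter_right, card_singleton] at h2
  omega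

theorem Decomposition.two_le_card {u v : V} {A M B : Finset V} (h : Decomposition G u v A M B) :
    2 ≤ #M :=
  one_lt_card.2 ⟨u, h.mem_left, v, h.mem_right, h.ne⟩

/-- Two gluings, at `v` and then at `u`. Each distance sum at a cut vertex is weighted by the number
of vertices that reach its piece through that vertex; the last term collects the passages through
`M` from `A` to `B`. -/
theorem Decomposition.pairSum_eq (hG : G.Connected) {u v : V} {A M B : Finset V}
    (h : Decomposition G u v A M B) {x y z : ℕ} (hx : #A = x + 2) (hy : #B = y + 2)
    (hz : #M = z + 2) :
    pairSum G univ =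
      (pairSum G A + 2 * ((y + z + 2) * distSum G A u)) +
      (pairSum G B + 2 * ((x + z + 2) * distSum G B v)) +
      (pairSum G M + 2 * ((x + 1) * distSum G M u) + 2 * ((y + 1) * distSum G M v)) +
      2 * ((x + 1) * (y + 1) * G.dist u v) := by
  have h1 := h.left.gate.pairSum_union hG h.inter_left
  have h2 := h.right.gate.pairSum_union hG h.inter_right
  have h3 := distSum_union (G := G) h.inter_right u
  have h4 : distSum G B u = (y + 2) * G.dist u v + distSum G B v := by
    have hb : ∀ b ∈ B, G.dist u b = G.dist u v + G.dist v b := fun b hb => by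
      rw [G.dist_comm (v := b), G.dist_comm (u := u) (v := v), G.dist_comm (u := v) (v := b),
        add_comm]
      refine h.right.gate.dist_eq hG hb (Or.inl fun huB => h.ne ?_)
      simpa [h.inter_right] using mem_inter.2 ⟨huB, h.mem_left⟩
    rw [← hy, distSum, sum_congr rfl hb, sum_add_distrib, sum_const, smul_eq_mul, distSum]
  have h5 : #(B ∪ M) = y + z + 3 := by
    have := card_union_add_card_inter B M
    rw [h.inter_right, card_singleton] at this
    omega
  have h6 : distSum G (B ∪ M) u = (y + 1) * G.dist u v + distSum G B v + distSum G M u := by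
    rw [h4] at h3
    linarith
  rw [h.union_eq, h5, h6, hx] at h1
  rw [hy, hz] at h2
  linarith

theorem Decomposition.pairSum_block_le (hG : G.Connected) {u v : V} {A M B : Finset V}
    (h : Decomposition G u v A M B) (x y : ℕ) :
    pairSum G M + 2 * ((x + 1) * distSum G M u) + 2 * ((y + 1) * distSum G M v) +
      2 * ((x + 1) * (y + 1) * G.dist u v) ≤
    #M * (#M ^ 2 / 4) + 2 * ((x + 1 + (y + 1)) * (#M ^ 2 / 4)) +
      2 * ((x + 1) * (y + 1) * (#M / 2)) := by
  have h1 := pairSum_le hG h.linked h.linked_erase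
  have h2 := Nat.mul_le_mul_left (x + 1) (distSum_le hG h.mem_left h.linked
    fun z hz _ => h.linked_erase z hz)
  have h3 := Nat.mul_le_mul_left (y + 1) (distSum_le hG h.mem_right h.linked
    fun z hz _ => h.linked_erase z hz)
  have h4 := Nat.mul_le_mul_left ((x + 1) * (y + 1)) (dist_le_half_card hG h.mem_left h.linked
    (fun z hz _ => h.linked_erase z hz) h.mem_right)
  linarith

theorem Decomposition.pairSum_le_bound (hG : G.Connected) {u v : V} {A M B : Finset V}
    (h : Decomposition G u v A M B) {x y z : ℕ} (hx : #A = x + 2) (hy : #B = y + 2)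
    (hz : #M = z + 2) : pairSum G univ ≤ twoCutBound x y z := by
  rw [h.pairSum_eq hG hx hy hz]
  have h1 := (h.left.bound hG _ le_rfl h.card_left (s := y + z + 2) (by omega)).2
  have h2 := (h.right.bound hG _ le_rfl h.card_right (s := x + z + 2) (by omega)).2
  have h3 := h.pairSum_block_le hG x y
  rw [hx] at h1
  rw [hy] at h2
  rw [hz] at h3
  unfold twoCutBound
  linarith

/-! ### The case of equality. -/

/-- A graph with exactly two cut vertices whose Wiener index is maximal is a pendant path of length
two attached to a block in which all distance sums are maximal. -/
structure Extremal (G : SimpleGraph V) (u v : V) (A M B : Finset V) : Prop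
    extends Decomposition G u v A M B where
  card_block : #A + 2 = Fintype.card V
  card_middle : #M = 2
  card_end : #B = 2
  block : ∀ z ∈ A, Linked G (A.erase z)
  distSum_eq : ∀ z ∈ A, distSum G A z = #A ^ 2 / 4

theorem Decomposition.extremal (hG : G.Connected) {u v : V} {A M B : Finset V}
    (h : Decomposition G u v A M B) (hV : 10 ≤ Fintype.card V) (hM : #M = 2) (hB : #B = 2)
    (heq : lollipopValue (Fintype.card V - 2) ≤ pairSum G univ) : Extremal G u v A M B := by
  have hc := h.card_eq
  obtain ⟨x, hx⟩ : ∃ x, #A = x + 2 := ⟨#A - 2, by omega⟩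
  have hext := twoCutBound_extreme (x := x) (by omega)
  rw [show Fintype.card V - 2 = x + 2 by omega, ← hext, h.pairSum_eq hG hx hB hM] at heq
  have h1 := h.left.bound hG _ le_rfl h.card_left (s := 0 + 0 + 2) (by omega)
  have h2 := (h.right.bound hG _ le_rfl h.card_right (s := x + 0 + 2) (by omega)).2
  have h3 := h.pairSum_block_le hG x 0
  rw [hB, if_neg (by norm_num)] at h2
  rw [hM] at h3
  rw [if_neg (by omega), if_neg (by omega), hx] at h1
  unfold twoCutBound at heq
  rw [if_neg (by omega), if_neg (by omega)] at heq
  simp only [Nat.reduceAdd, Nat.reducePow, Nat.reduceDiv] at heq h2 h3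
  -- The pieces `M` and `B` contribute at most their bounds, so `A` must attain its own; the strict
  -- alternative in `Star.bound` is then impossible, and `A` is a block.
  have hlow : (x + 2) * ((x + 2) ^ 2 / 4) + 2 * ((0 + 0 + 2) * ((x + 2) ^ 2 / 4)) ≤
      pairSum G A + 2 * ((0 + 0 + 2) * distSum G A u) := by
    linarith
  have hblk : Linked G (A.erase u) := by
    refine h1.1.resolve_right fun h => ?_
    omega
  have hall := h.left.linked_erase_all hblk
  have hle : ∀ w ∈ A, distSum G A w ≤ #A ^ 2 / 4 := fun w hw =>
    distSum_le hG hw h.left.linked fun z hz _ => hall z hz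
  refine ⟨h, by omega, hM, hB, hall, ?_⟩
  refine (sum_eq_sum_iff_of_le hle).1 (le_antisymm (sum_le_sum hle) ?_)
  rw [sum_const, smul_eq_mul, hx]
  have h4 := hle u h.left.mem
  rw [hx] at h4
  have h5 : pairSum G A = ∑ w ∈ A, distSum G A w := rfl
  omega

theorem pairSum_le_lollipopValue (hG : G.Connected) {u v : V} {A M B : Finset V}
    (h : Decomposition G u v A M B) (hV : 10 ≤ Fintype.card V) :
    pairSum G univ ≤ lollipopValue (Fintype.card V - 2) ∧
      (pairSum G univ = lollipopValue (Fintype.card V - 2) →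
        ∃ u v A M B, Extremal G u v A M B) := by
  have hc := h.card_eq
  have hA := h.card_left
  have hB := h.card_right
  have hM := h.two_le_card
  obtain ⟨x, hx⟩ : ∃ x, #A = x + 2 := ⟨#A - 2, by omega⟩
  obtain ⟨y, hy⟩ : ∃ y, #B = y + 2 := ⟨#B - 2, by omega⟩
  obtain ⟨z, hz⟩ : ∃ z, #M = z + 2 := ⟨#M - 2, by omega⟩
  have hle := h.pairSum_le_bound hG hx hy hz
  have hn : Fintype.card V - 2 = x + y + z + 2 := by omega
  by_cases hne : z ≠ 0 ∨ (x ≠ 0 ∧ y ≠ 0)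
  · have := twoCutBound_lt (by omega) hne
    rw [hn]
    exact ⟨by omega, fun _ => by omega⟩
  · obtain rfl : z = 0 := by omega
    have hxy : x = 0 ∨ y = 0 := by omega
    rcases hxy with rfl | rfl
    · rw [twoCutBound_comm, twoCutBound_extreme (by omega)] at hle
      refine ⟨by rw [hn]; simpa using hle, fun heq => ⟨v, u, B, M, A, ?_⟩⟩
      exact h.symm.extremal hG hV hz hx heq.ge
    · rw [twoCutBound_extreme (by omega)] at hle
      refine ⟨by rw [hn]; simpa using hle, fun heq => ⟨u, v, A, M, B, ?_⟩⟩
      exact h.extremal hG hV hz hy heq.ge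

end TwoCutVertices

/-! ### The Wiener index as a sum over ordered pairs, and lower bounds for distances. -/

section Distances

variable {V : Type*} {G : SimpleGraph V}

theorem two_mul_sum_sym2 (S : Finset V) :
    2 * ∑ p ∈ S.sym2, Sym2.lift ⟨fun u v => G.dist u v, fun _ _ => SimpleGraph.dist_comm⟩ p =
      pairSum G S := by
  induction S using Finset.cons_induction with
  | empty => rfl
  | cons a S ha ih =>
    rw [sym2_cons, sum_disjUnion, mul_add, ih, sum_map, sum_cons,
      show pairSum G (cons a S ha) = ∑ x ∈ cons a S ha, distSum G (cons a S ha) x from rfl, sum_cons]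
    have h1 : ∀ x ∈ S, distSum G (cons a S ha) x = G.dist a x + distSum G S x := fun x _ => by
      rw [distSum, sum_cons, G.dist_comm, distSum]
    rw [sum_congr rfl h1, sum_add_distrib, distSum, sum_cons]
    simp [pairSum]
    ring

theorem two_mul_wienerIndex [Fintype V] : 2 * wienerIndex G = pairSum G univ :=
  two_mul_sum_sym2 univ

/-- The Wiener index is invariant under isomorphisms. -/
theorem wienerIndex_eq_of_iso {W : Type*} [Fintype V] [Fintype W] {H : SimpleGraph W}
    (e : G ≃g H) : wienerIndex G = wienerIndex H := by
  have hd : ∀ x y, G.dist x y = H.dist (e x) (e y) := by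
    -- The extended distance is an infimum over all walks, so no connectedness is needed.
    have hle : ∀ x y, H.edist (e x) (e y) ≤ G.edist x y := fun x y => by
      refine le_iInf fun p => ?_
      simpa using H.edist_le (p.map e.toHom)
    have hge : ∀ x y, G.edist x y ≤ H.edist (e x) (e y) := fun x y => by
      refine le_iInf fun p => ?_
      simpa using G.edist_le ((p.map e.symm.toHom).copy (e.symm_apply_apply x)
        (e.symm_apply_apply y))
    exact fun x y => congrArg ENat.toNat (le_antisymm (hge x y) (hle x y))
  have : pairSum G univ = pairSum H univ := by
    simp only [pairSum, distSum]
    refine Fintype.sum_equiv e.toEquiv _ _ fun x => ?_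
    exact Fintype.sum_equiv e.toEquiv _ _ fun y => hd x y
  have h1 := two_mul_wienerIndex (G := G)
  have h2 := two_mul_wienerIndex (G := H)
  omega

/-- `φ` grows by at most one per edge of a shortest walk. A guessed distance function is thereby a
lower bound without any shortest paths being exhibited. -/
theorem le_dist_of_lipschitz (hG : G.Connected) {x y : V} (φ : V → ℕ) (h0 : φ x = 0)
    (hφ : ∀ a b, G.Adj a b → φ b ≤ φ a + 1) : φ y ≤ G.dist x y := by
  obtain ⟨p, hp⟩ := hG.exists_walk_length_eq_dist x y
  have key : ∀ (a b : V) (q : G.Walk a b), φ b ≤ φ a + q.length := by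
    intro a b q
    induction q with
    | nil => simp
    | @cons a c b hac q ih =>
      have := hφ a c hac
      rw [SimpleGraph.Walk.length_cons]
      omega
  have := key x y p
  omega

end Distances

/-! ### A lower bound for the Wiener index of the cycle with a pendant path. -/

section Lollipop

/-- The distance of `i` and `j` in the cycle on `0, …, m - 1`. -/
def cycleDist (m i j : ℕ) : ℕ := min (max i j - min i j) (m - (max i j - min i j))

/-- The distance of `i` and `j` in the cycle on `0, …, m - 1` with a path attached at `m - 1`. -/
def lollipopDist (m i j : ℕ) : ℕ :=
  cycleDist m (min i (m - 1)) (min j (m - 1)) + (max i j - max (min i j) (m - 1))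

theorem sum_cycleDist_zero (m : ℕ) : ∑ j ∈ range m, cycleDist m 0 j = m ^ 2 / 4 := by
  induction m using Nat.twoStepInduction with
  | zero => rfl
  | one => rfl
  | more m ih _ =>
    rw [sum_range_succ', sum_range_succ]
    have h1 : ∀ j ∈ range m, cycleDist (m + 2) 0 (j + 1) = cycleDist m 0 j + 1 := fun j hj => by
      rw [mem_range] at hj
      simp only [cycleDist]
      omega
    rw [sum_congr rfl h1, sum_add_distrib, ih, sum_const, card_range]
    have h2 : (m + 2) ^ 2 = m ^ 2 + (m + 1) * 4 := by ring
    rw [h2, Nat.add_mul_div_right _ _ (by norm_num)]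
    simp only [cycleDist, smul_eq_mul]
    omega

/-- Rotation invariance: passing from `i` to `i + 1` shifts the summands cyclically. -/
theorem sum_cycleDist {m i : ℕ} (hi : i < m) : ∑ j ∈ range m, cycleDist m i j = m ^ 2 / 4 := by
  induction i with
  | zero => exact sum_cycleDist_zero m
  | succ i ih =>
    obtain ⟨m, rfl⟩ : ∃ m', m = m' + 1 := ⟨m - 1, by omega⟩
    rw [← ih (by omega), sum_range_succ', sum_range_succ]
    congr 1
    · refine sum_congr rfl fun j _ => ?_
      simp only [cycleDist]
      omega
    · simp only [cycleDist]
      omega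

theorem cyclePath_adj {n g : ℕ} {i j : Fin n} (hij : i < j) :
    (cyclePath n g).Adj i j ↔ i.val + 1 = j.val ∨ (i.val = 0 ∧ j.val + 1 = g) := by
  have h1 : i.val < j.val := hij
  have h2 : i ≠ j := hij.ne
  simp only [cyclePath, SimpleGraph.fromRel_adj]
  constructor
  · rintro ⟨-, h | h⟩ <;> omega
  · exact fun h => ⟨h2, Or.inl h⟩

theorem cyclePath_connected (n g : ℕ) : (cyclePath (n + 1) g).Connected := by
  have key : ∀ (k : ℕ) (hk : k < n + 1), (cyclePath (n + 1) g).Reachable 0 ⟨k, hk⟩ := by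
    intro k
    induction k with
    | zero => exact fun _ => SimpleGraph.Reachable.refl _
    | succ k ih =>
      intro hk
      refine (ih (by omega)).trans (SimpleGraph.Adj.reachable ?_)
      exact (cyclePath_adj (Fin.mk_lt_mk.2 k.lt_succ_self)).2 (Or.inl rfl)
  have : Nonempty (Fin (n + 1)) := ⟨0⟩
  exact ⟨fun a b => (key a.1 a.2).symm.trans (key b.1 b.2)⟩

theorem cycleDist_succ_le {m i j : ℕ} (hj : j + 1 < m) (hi : i < m) :
    cycleDist m i (j + 1) ≤ cycleDist m i j + 1 ∧ cycleDist m i j ≤ cycleDist m i (j + 1) + 1 := by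
  unfold cycleDist
  rcases le_or_gt i j with h | h
  · rw [max_eq_right h, min_eq_left h, max_eq_right (by omega : i ≤ j + 1),
      min_eq_left (by omega : i ≤ j + 1)]
    omega
  · rw [max_eq_left h.le, min_eq_right h.le, max_eq_left (by omega : j + 1 ≤ i),
      min_eq_right (by omega : j + 1 ≤ i)]
    omega

theorem cycleDist_wrap_le {m i : ℕ} (hi : i < m) :
    cycleDist m i 0 ≤ cycleDist m i (m - 1) + 1 ∧
      cycleDist m i (m - 1) ≤ cycleDist m i 0 + 1 := by
  unfold cycleDist
  rw [max_eq_left (Nat.zero_le i), min_eq_right (Nat.zero_le i),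
    max_eq_right (by omega : i ≤ m - 1), min_eq_left (by omega : i ≤ m - 1)]
  omega

theorem lollipopDist_of_lt {m i j : ℕ} (hj : j < m) :
    lollipopDist m i j = cycleDist m (min i (m - 1)) j + (i - (m - 1)) := by
  unfold lollipopDist
  rw [min_eq_left (by omega : j ≤ m - 1)]
  omega

theorem lollipopDist_of_ge {m i j : ℕ} (hj : m - 1 ≤ j) :
    lollipopDist m i j = cycleDist m (min i (m - 1)) (m - 1) +
      (max i j - max (min i j) (m - 1)) := by
  unfold lollipopDist
  rw [min_eq_right hj]

theorem lollipopDist_succ_le {m : ℕ} (hm : 3 ≤ m) (i j : ℕ) :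
    lollipopDist m i (j + 1) ≤ lollipopDist m i j + 1 ∧
      lollipopDist m i j ≤ lollipopDist m i (j + 1) + 1 := by
  rcases lt_or_ge (j + 1) m with h | h
  · have := cycleDist_succ_le (i := min i (m - 1)) h (by omega)
    rw [lollipopDist_of_lt h, lollipopDist_of_lt (by omega)]
    omega
  · rw [lollipopDist_of_ge (by omega), lollipopDist_of_ge (by omega)]
    omega

theorem lollipopDist_wrap_le {m : ℕ} (hm : 3 ≤ m) (i : ℕ) :
    lollipopDist m i 0 ≤ lollipopDist m i (m - 1) + 1 ∧
      lollipopDist m i (m - 1) ≤ lollipopDist m i 0 + 1 := by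
  have := cycleDist_wrap_le (m := m) (i := min i (m - 1)) (by omega)
  rw [lollipopDist_of_lt (by omega), lollipopDist_of_lt (by omega)]
  omega

theorem lollipopDist_le_dist {m : ℕ} (hm : 3 ≤ m) (i j : Fin (m + 2)) :
    lollipopDist m i j ≤ (cyclePath (m + 2) m).dist i j := by
  refine le_dist_of_lipschitz (cyclePath_connected (m + 1) m) (fun j => lollipopDist m i j) ?_ ?_
  · simp only [lollipopDist, cycleDist]
    omega
  · have key : ∀ a b : Fin (m + 2), a < b → (cyclePath (m + 2) m).Adj a b →
        lollipopDist m i b ≤ lollipopDist m i a + 1 ∧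
          lollipopDist m i a ≤ lollipopDist m i b + 1 := by
      intro a b h hab
      rcases (cyclePath_adj h).1 hab with h' | ⟨h', h''⟩
      · rw [← h']
        exact lollipopDist_succ_le hm _ _
      · rw [h', show b.1 = m - 1 by omega]
        exact (lollipopDist_wrap_le hm _).symm
    intro a b hab
    rcases lt_or_gt_of_ne hab.ne with h | h
    · exact (key a b h hab).1
    · exact (key b a h hab.symm).2

theorem lollipopValue_le {m : ℕ} (hm : 3 ≤ m) :
    lollipopValue m ≤ 2 * wienerIndex (cyclePath (m + 2) m) := by
  have h1 : ∑ i : Fin (m + 2), ∑ j : Fin (m + 2), lollipopDist m i j ≤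
      2 * wienerIndex (cyclePath (m + 2) m) := by
    rw [two_mul_wienerIndex]
    exact sum_le_sum fun i _ => sum_le_sum fun j _ => lollipopDist_le_dist hm i j
  refine le_trans (le_of_eq ?_) h1
  have e1 : ∀ i : Fin (m + 2), ∑ j : Fin (m + 2), lollipopDist m i j =
      ∑ j ∈ range (m + 2), lollipopDist m i j := fun i =>
    Fin.sum_univ_eq_sum_range (fun j => lollipopDist m i j) (m + 2)
  rw [sum_congr rfl fun i _ => e1 i,
    Fin.sum_univ_eq_sum_range (fun i => ∑ j ∈ range (m + 2), lollipopDist m i j) (m + 2)]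
  have e2 : ∀ i ∈ range m, ∑ j ∈ range m, lollipopDist m i j = m ^ 2 / 4 := fun i hi => by
    rw [mem_range] at hi
    rw [← sum_cycleDist hi]
    refine sum_congr rfl fun j hj => ?_
    rw [mem_range] at hj
    simp only [lollipopDist, cycleDist]
    omega
  have e3 : ∀ i ∈ range m, lollipopDist m i m = cycleDist m (m - 1) i + 1 := fun i hi => by
    rw [mem_range] at hi
    simp only [lollipopDist, cycleDist]
    omega
  have e4 : ∀ i ∈ range m, lollipopDist m i (m + 1) = cycleDist m (m - 1) i + 2 := fun i hi => by
    rw [mem_range] at hi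
    simp only [lollipopDist, cycleDist]
    omega
  have e5 : ∀ i ∈ range m, lollipopDist m m i = cycleDist m (m - 1) i + 1 := fun i hi => by
    rw [mem_range] at hi
    simp only [lollipopDist, cycleDist]
    omega
  have e6 : ∀ i ∈ range m, lollipopDist m (m + 1) i = cycleDist m (m - 1) i + 2 := fun i hi => by
    rw [mem_range] at hi
    simp only [lollipopDist, cycleDist]
    omega
  have e7 : lollipopDist m m m = 0 := by simp [lollipopDist, cycleDist]
  have e8 : lollipopDist m (m + 1) (m + 1) = 0 := by simp [lollipopDist, cycleDist]
  have e9 : lollipopDist m m (m + 1) = 1 := by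
    simp only [lollipopDist, cycleDist]
    omega
  have e10 : lollipopDist m (m + 1) m = 1 := by
    simp only [lollipopDist, cycleDist]
    omega
  simp only [sum_range_succ, sum_add_distrib]
  rw [sum_congr rfl e2, sum_congr rfl e3, sum_congr rfl e4, sum_congr rfl e5, sum_congr rfl e6,
    e7, e8, e9, e10]
  simp only [sum_add_distrib, sum_const, card_range, smul_eq_mul,
    sum_cycleDist (show m - 1 < m by omega)]
  unfold lollipopValue
  ring

end Lollipop

/-! ### Recognising the extremal graph. -/

section Cycle

variable {V : Type*} {G : SimpleGraph V}

theorem linked_univ [Fintype V] (hG : G.Connected) : Linked G univ := by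
  apply linked_of_preconnected
  rw [coe_univ]
  exact (SimpleGraph.induceUnivIso G).preconnected_iff.2 hG.preconnected

variable [DecidableEq V]

theorem Linked.adj_of_card_eq_two {S : Finset V} (h : Linked G S) (hS : #S = 2) {a b : V}
    (ha : a ∈ S) (hb : b ∈ S) (hab : a ≠ b) : G.Adj a b := by
  by_contra hn
  have hSab : ∀ y ∈ S, y = a ∨ y = b := by
    have : ({a, b} : Finset V) = S := eq_of_subset_of_card_le
      (by simp [insert_subset_iff, ha, hb]) (by rw [hS, card_pair hab])
    intro y hy
    simpa [← this] using hy
  have := h {a} (by simpa using ha) (by simp) ?_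
  · rw [← this, card_singleton] at hS
    omega
  · intro x hx y hy hyn
    rw [mem_singleton] at hx hyn
    rw [hx, (hSab y hy).resolve_left hyn]
    exact hn

/-- A linked set in which all degrees are two is traversed by a cycle. -/
theorem exists_cycle_of_card_adj {S : Finset V} (h : Linked G S) [DecidableRel G.Adj]
    (hdeg : ∀ w ∈ S, #{x ∈ S | G.Adj w x} = 2) {u : V} (hu : u ∈ S) :
    ∃ c : ℕ → V, c 0 = u ∧ c #S = u ∧ (∀ i, c i ∈ S) ∧ Set.InjOn c (Set.Icc 1 #S) ∧
      ∀ i < #S, G.Adj (c i) (c (i + 1)) := by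
  set H := G.induce (S : Set V)
  have hn : ∀ w : (S : Set V), (H.neighborSet w).ncard = 2 := by
    intro w
    rw [← hdeg w.1 w.2, ← Set.ncard_coe_finset, ← Set.ncard_image_of_injective _
      Subtype.val_injective]
    congr 1
    ext x
    simp only [Set.mem_image, SimpleGraph.mem_neighborSet, coe_filter, Set.mem_ofPred_eq]
    constructor
    · rintro ⟨y, hy, rfl⟩
      exact ⟨y.2, hy⟩
    · exact fun hx => ⟨⟨x, hx.1⟩, hx.2, rfl⟩
  have hcyc : H.IsCycles := fun w _ => hn w
  obtain ⟨p, hp, hverts⟩ := hcyc.exists_cycle_toSubgraph_verts_eq_connectedComponentSupp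
    (v := ⟨u, hu⟩) (c := H.connectedComponentMk ⟨u, hu⟩) rfl
    (Set.nonempty_of_ncard_ne_zero (by rw [hn]; norm_num))
  have hinj := hp.getVert_injOn
  have hinj' : Set.InjOn (fun i => (p.getVert i).1) (Set.Icc 1 p.length) :=
    fun i hi j hj hij => hinj hi hj (Subtype.ext hij)
  have himg : (Icc 1 p.length).image (fun i => (p.getVert i).1) = S := by
    ext x
    simp only [mem_image, mem_Icc]
    constructor
    · rintro ⟨i, -, rfl⟩
      exact (p.getVert i).2
    · intro hx
      have hx' : (⟨x, hx⟩ : (S : Set V)) ∈ p.toSubgraph.verts := by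
        rw [hverts]
        exact SimpleGraph.ConnectedComponent.sound (h.preconnected _ _)
      rw [SimpleGraph.Walk.mem_verts_toSubgraph, SimpleGraph.Walk.mem_support_iff_exists_getVert]
        at hx'
      obtain ⟨i, hi, hil⟩ := hx'
      rcases i.eq_zero_or_pos with rfl | hpos
      · refine ⟨p.length, ⟨by have := hp.three_le_length; omega, le_rfl⟩, ?_⟩
        rw [SimpleGraph.Walk.getVert_zero] at hi
        rw [SimpleGraph.Walk.getVert_length, hi]
      · exact ⟨i, ⟨hpos, hil⟩, by rw [hi]⟩
  have hlen : #S = p.length := by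
    have := congrArg card himg
    rw [card_image_of_injOn (by simpa using hinj'), Nat.card_Icc] at this
    omega
  refine ⟨fun i => (p.getVert i).1, by simp, by simp [hlen], fun i => (p.getVert i).2, ?_, ?_⟩
  · rwa [hlen]
  · intro i hi
    exact p.adj_getVert_succ (hlen ▸ hi)

/-- The predecessor and the successor on the cycle are two distinct neighbours, so with degree two
there are no chords. -/
theorem cycle_adj {S : Finset V} [DecidableRel G.Adj] (hdeg : ∀ w ∈ S, #{x ∈ S | G.Adj w x} = 2)
    (h3 : 3 ≤ #S) {c : ℕ → V} (h0 : c 0 = c #S) (hc : ∀ i, c i ∈ S)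
    (hinj : Set.InjOn c (Set.Icc 1 #S)) (hadj : ∀ i < #S, G.Adj (c i) (c (i + 1))) {i j : ℕ}
    (hi : 1 ≤ i) (hij : i < j) (hj : j ≤ #S) :
    G.Adj (c i) (c j) ↔ i + 1 = j ∨ (i = 1 ∧ j = #S) := by
  -- `k` is the index of the predecessor, taken in the injective range: for `i = 1` it is `#S`
  -- instead of 0.
  obtain ⟨k, hk, hck, hik⟩ : ∃ k, (1 ≤ k ∧ k ≤ #S) ∧ c (i - 1) = c k ∧
      (i = 1 ∧ k = #S ∨ k + 1 = i) := by
    rcases hi.eq_or_lt with rfl | hi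
    · exact ⟨#S, ⟨by omega, le_rfl⟩, by simpa using h0, Or.inl ⟨rfl, rfl⟩⟩
    · exact ⟨i - 1, ⟨by omega, by omega⟩, rfl, by omega⟩
  have hk_adj : G.Adj (c i) (c k) := by
    have := hadj (i - 1) (by omega)
    rw [Nat.sub_add_cancel hi, hck] at this
    exact this.symm
  have hne : c k ≠ c (i + 1) := fun h => by
    have := hinj hk ⟨by omega, by omega⟩ h
    omega
  have hset : {c k, c (i + 1)} = ({x ∈ S | G.Adj (c i) x} : Finset V) := by
    refine eq_of_subset_of_card_le ?_ (by rw [hdeg _ (hc i), card_pair hne])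
    intro x hx
    rw [mem_insert, mem_singleton] at hx
    rcases hx with rfl | rfl
    · exact mem_filter.2 ⟨hc _, hk_adj⟩
    · exact mem_filter.2 ⟨hc _, hadj i (by omega)⟩
  constructor
  · intro h
    have hm : c j ∈ ({c k, c (i + 1)} : Finset V) := hset ▸ mem_filter.2 ⟨hc j, h⟩
    rw [mem_insert, mem_singleton] at hm
    rcases hm with hm | hm
    · have := hinj ⟨by omega, hj⟩ hk hm
      omega
    · have := hinj ⟨by omega, hj⟩ ⟨by omega, by omega⟩ hm
      omega
  · rintro (rfl | ⟨rfl, rfl⟩)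
    · exact hadj i (by omega)
    · obtain rfl : k = #S := by omega
      exact hk_adj

theorem Extremal.nonempty_iso [Fintype V] (hG : G.Connected) {u v : V} {A M B : Finset V}
    (h : Extremal G u v A M B) {m : ℕ} (hm : 3 ≤ m) (hV : Fintype.card V = m + 2) :
    Nonempty (G ≃g cyclePath (m + 2) m) := by
  classical
  have hA : #A = m := by
    have := h.card_block
    omega
  have hdeg : ∀ w ∈ A, #{x ∈ A | G.Adj w x} = 2 := fun w hw => by
    rw [← card_adj_of_distSum_eq hG hw h.left.linked (fun z hz _ => h.block z hz) (by omega)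
      (h.distSum_eq w hw)]
    simp only [SimpleGraph.dist_eq_one_iff_adj]
  obtain ⟨c, h0, hend, hc, hinj, hadj⟩ :=
    exists_cycle_of_card_adj h.left.linked hdeg h.left.mem
  have hcadj := fun {i j : ℕ} => cycle_adj hdeg (by omega) (h0.trans hend.symm) hc hinj hadj
    (i := i) (j := j)
  rw [hA] at hend hinj
  simp only [hA] at hcadj
  obtain ⟨b, hb, hbv⟩ := exists_mem_ne (by rw [h.card_end]; norm_num) v
  have huv := h.linked.adj_of_card_eq_two h.card_middle h.mem_left h.mem_right h.ne
  have hvb := h.right.linked.adj_of_card_eq_two h.card_end h.right.mem hb hbv.symm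
  have huB : u ∉ B := fun hu => h.ne (by simpa [h.inter_right] using mem_inter.2 ⟨hu, h.mem_left⟩)
  have hAB : ∀ x ∈ A, x ∉ B := fun x hx hxB => by
    have hxu : x = u := by
      simpa [h.inter_left] using mem_inter.2 ⟨hx, mem_union_left M hxB⟩
    exact huB (hxu ▸ hxB)
  have hvA : v ∉ A := fun hv => hAB v hv h.right.mem
  -- The shift by one puts `u = c m` at position `m - 1`, where the path is attached; `v` and the
  -- end vertex `b` follow.
  let f : Fin (m + 2) → V := fun i => if i.1 < m then c (i.1 + 1) else if i.1 = m then v else b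
  have f1 : ∀ i : Fin (m + 2), i.1 < m → f i = c (i.1 + 1) := fun i hi => if_pos hi
  have f2 : ∀ i : Fin (m + 2), i.1 = m → f i = v := fun i hi => by simp [f, hi]
  have f3 : ∀ i : Fin (m + 2), i.1 = m + 1 → f i = b := fun i hi => by simp [f, hi]
  have hlt : ∀ i j : Fin (m + 2), i < j →
      f i ≠ f j ∧ (G.Adj (f i) (f j) ↔ (cyclePath (m + 2) m).Adj i j) := by
    intro i j hij
    rw [cyclePath_adj hij]
    have hij' : i.1 < j.1 := hij
    have hj := j.2
    rcases (by omega : j.1 < m ∨ j.1 = m ∨ j.1 = m + 1) with hjm | hjm | hjm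
    · rw [f1 i (by omega), f1 j hjm, hcadj (by omega) (by omega) (by omega)]
      refine ⟨fun he => ?_, by omega⟩
      have := hinj ⟨by omega, by omega⟩ ⟨by omega, by omega⟩ he
      omega
    · rw [f1 i (by omega), f2 j hjm]
      refine ⟨fun he => hvA (he ▸ hc _), ?_⟩
      by_cases hi : i.1 + 1 = m
      · rw [hi, hend]
        exact ⟨fun _ => Or.inl (by omega), fun _ => huv⟩
      · refine ⟨fun ha => ?_, by omega⟩
        refine absurd ha (h.left.gate _ (hc _) (fun he => hi ?_) v hvA)
        exact hinj ⟨by omega, by omega⟩ ⟨by omega, le_rfl⟩ (he.trans hend.symm)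
    · rw [f3 j hjm]
      rcases (by omega : i.1 < m ∨ i.1 = m) with him | him
      · rw [f1 i him]
        refine ⟨fun he => hAB _ (hc _) (he ▸ hb), ?_⟩
        refine ⟨fun ha => absurd ha.symm (h.right.gate b hb hbv _ (hAB _ (hc _))), by omega⟩
      · rw [f2 i him]
        exact ⟨hbv.symm, fun _ => Or.inl (by omega), fun _ => hvb⟩
  have hinjf : Function.Injective f := fun i j hf => by
    rcases lt_trichotomy i j with hij | hij | hij
    · exact absurd hf (hlt i j hij).1
    · exact hij
    · exact absurd hf.symm (hlt j i hij).1
  have hbij : Function.Bijective f :=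
    (Fintype.bijective_iff_injective_and_card f).2 ⟨hinjf, by simp [hV]⟩
  refine ⟨SimpleGraph.Iso.symm ⟨Equiv.ofBijective f hbij, fun {i j} => ?_⟩⟩
  rw [Equiv.ofBijective_apply, Equiv.ofBijective_apply]
  rcases lt_trichotomy i j with hij | rfl | hij
  · exact (hlt i j hij).2
  · simp
  · rw [G.adj_comm, (hlt j i hij).2, SimpleGraph.adj_comm]

theorem linked_erase_iff [Fintype V] (z : V) :
    Linked G (univ.erase z) ↔ ¬ IsCutVertex G z := by
  have hz : (({z}ᶜ : Set V)) = ((univ.erase z : Finset V) : Set V) := by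
    ext x
    simp
  rw [IsCutVertex, not_not, hz]
  exact ⟨Linked.preconnected, linked_of_preconnected⟩

end Cycle

end WienerCut

theorem theorem5p7 {V : Type*} [Fintype V] (n : ℕ) (hn : 10 ≤ n) (hV : Fintype.card V = n)
    (G : SimpleGraph V) (hG : G.Connected) (hcut : WienerCut.numCutVertices G = 2) :
    WienerCut.wienerIndex G ≤ WienerCut.wienerIndex (WienerCut.cyclePath n (n - 2)) ∧
      (WienerCut.wienerIndex G = WienerCut.wienerIndex (WienerCut.cyclePath n (n - 2)) ↔
        Nonempty (G ≃g WienerCut.cyclePath n (n - 2))) := by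
  classical
  obtain ⟨m, rfl⟩ : ∃ m, n = m + 2 := ⟨n - 2, by omega⟩
  rw [Nat.add_sub_cancel]
  obtain ⟨u, v, huv, hset⟩ := Set.ncard_eq_two.1 hcut
  have hmem : ∀ z, WienerCut.IsCutVertex G z ↔ z = u ∨ z = v := fun z => by
    simpa using Set.ext_iff.1 hset z
  obtain ⟨A, M, B, hdec⟩ := WienerCut.exists_decomposition huv (WienerCut.linked_univ hG)
    (by rw [WienerCut.linked_erase_iff, hmem]; simp)
    (by rw [WienerCut.linked_erase_iff, hmem]; simp)
    (fun z hzu hzv => by rw [WienerCut.linked_erase_iff, hmem]; tauto)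
  have hmain := WienerCut.pairSum_le_lollipopValue hG hdec (by omega)
  rw [hV, Nat.add_sub_cancel, ← WienerCut.two_mul_wienerIndex] at hmain
  have hlow := WienerCut.lollipopValue_le (m := m) (by omega)
  refine ⟨by omega, fun heq => ?_, fun ⟨e⟩ => WienerCut.wienerIndex_eq_of_iso e⟩
  -- Equal Wiener indices collapse 2 W(G) ≤ `lollipopValue m` ≤ 2 W(L), so `G` attains the bound.
  obtain ⟨u, v, A, M, B, hext⟩ := hmain.2 (by omega)
  exact hext.nonempty_iso hG (by omega) hV
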